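/- Let $G=(V,E)$ be a finite directed graph, loops and multiple edges allowed, in which every vertex $w$ has out-degree $d_w\ge 2$, and which is strongly connected: for all $u,v\in V$ there is a directed path (with at least one edge) from $u$ to $v$. Let $(S_e)_{e\in E}$ be a graph-directed iterated function system (GD-IFS) on $\mathbb R$ based on $G$, that is, $S_e(t)=\rho_e t+b_e$ with $\rho_e\in(-1,1)\setminus\{0\}$ and $b_e\in\mathbb R$ for each edge $e$. Write $\alpha(e)$ and $\omega(e)$ for the initial and terminal vertex of $e$. Let $(F_w)_{w\in V}$ be its attractors, the unique non-empty compact sets with $$F_w=\bigcup_{e:\ \alpha(e)=w}S_e(F_{\omega(e)})\qquad(w\in V).$$ Assume that the GD-IFS satisfies the convex open set condition (COSC): there are non-empty bounded open convex sets $U_w\subset\mathbb R$ $(w\in V)$ such that, for each $w$, the sets $S_e(U_{\omega(e)})$ with $\alpha(e)=w$ are pairwise disjoint and contained in $U_w$. For $w\in V$, let $e_w^{(1)},\dots,e_w^{(d_w)}$ be the edges leaving $w$, ordered so that the compact intervals $J_w^{(k)}=S_{e}(\operatorname{conv}F_{\omega(e)})$, $e=e_w^{(k)}$, run from left to right. For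 $1\le k\le d_w-1$ let $\lambda_w^{(k)}=\min J_w^{(k+1)}-\max J_w^{(k)}$ be the length of the $k$-th basic gap at $w$, and let $\Lambda_w=\{\lambda_w^{(k)}:\lambda_w^{(k)}>0\}$. Let $A=\{|\rho_e|:e\in E\}=\{a_1,\dots,a_n\}$ with $a_1,\dots,a_n$ distinct, let $A^{\mathbb Q}$ be the set of all products $\prod_{i=1}^n a_i^{m_i}$ with $(m_i)\in\mathbb Q^n$, and let $A^{\mathbb Q^*}$ be the set of such products with $(m_i)\in\mathbb Q^n\setminus\{0\}$. Suppose that 1. the numbers $|\rho_e|$, $e\in E$, are pairwise different, and $1\notin A^{\mathbb Q^*}$; 2. $\Lambda_w\ne\emptyset$ for every $w\in V$; 3. for all pairs $(w,k)\ne(z,m)$ with $w,z\in V$, $1\le k\le d_w-1$, $1\le m\le d_z-1$ and $\lambda_z^{(m)}\ne0$, one has $\lambda_w^{(k)}/\lambda_z^{(m)}\notin A^{\mathbb Q}$. Let $u\in V$ be a vertex such that $G$ contains a directed circuit (a directed path with at least one edge that ends at its initial vertex) not passing through $u$. Then $F_u$ is not the attractor of any standard IFS satisfying the COSC: there is no finite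 set $T$ of contracting similarities $t\mapsto\rho t+b$ of $\mathbb R$, $\rho\in(-1,1)\setminus\{0\}$, such that $F_u=\bigcup_{f\in T}f(F_u)$ and such that, for some non-empty open convex set $U\subset\mathbb R$, the sets $f(U)$, $f\in T$, are pairwise disjoint and contained in $U$. -/

import Mathlib

namespace GDIFS

/-- A contracting similarity `t ↦ ratio * t + shift` of the real line, with
`ratio ∈ (-1, 1) \ {0}`. -/
structure ContractingSimilarity where
  ratio : ℝ
  shift : ℝ
  ratio_ne_zero : ratio ≠ 0
  abs_ratio_lt_one : |ratio| < 1

/-- The map of the real line given by a contracting similarity. -/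
def ContractingSimilarity.toFun (f : ContractingSimilarity) (t : ℝ) : ℝ :=
  f.ratio * t + f.shift

instance : CoeFun ContractingSimilarity (fun _ => ℝ → ℝ) :=
  ⟨ContractingSimilarity.toFun⟩

/-! ### Standard iterated function systems -/

/-- `K` is the attractor of the standard IFS `T` (a finite set of contracting similarities): the
non-empty compact set with `K = ⋃ f ∈ T, f(K)`. -/
def IsAttractor (T : Finset ContractingSimilarity) (K : Set ℝ) : Prop :=
  K.Nonempty ∧ IsCompact K ∧ K = ⋃ f ∈ T, f '' K

/-- The convex open set condition for a standard IFS. -/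
def StandardCOSC (T : Finset ContractingSimilarity) : Prop :=
  ∃ U : Set ℝ, U.Nonempty ∧ IsOpen U ∧ Convex ℝ U ∧
    (∀ f ∈ T, f '' U ⊆ U) ∧
    ∀ f ∈ T, ∀ g ∈ T, f ≠ g → Disjoint (f '' U) (g '' U)

/-! ### Directed graphs, with loops and multiple edges allowed -/

/-- A directed graph with vertex set `V` and edge set `E`; loops and multiple edges are allowed. -/
structure MultiDigraph (V E : Type*) where
  /-- the initial vertex of an edge -/
  src : E → V
  /-- the terminal vertex of an edge -/
  tgt : E → V

namespace MultiDigraph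

variable {V E : Type*}

/-- The consecutive edges in the list lead from the first vertex to the second one. -/
def IsWalk (G : MultiDigraph V E) : V → V → List E → Prop
  | u, v, [] => u = v
  | u, v, e :: p => G.src e = u ∧ IsWalk G (G.tgt e) v p

/-- A directed path from `u` to `v`: a non-empty consecutive sequence of edges. -/
def IsPath (G : MultiDigraph V E) (u v : V) (p : List E) : Prop :=
  p ≠ [] ∧ G.IsWalk u v p

/-- A directed circuit: a directed path that ends where it starts. -/
def IsCircuit (G : MultiDigraph V E) (p : List E) : Prop :=
  ∃ v, G.IsPath v v p

/-- The path `p` visits the vertex `u`. -/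
def PassesThrough (G : MultiDigraph V E) (p : List E) (u : V) : Prop :=
  ∃ e ∈ p, G.src e = u ∨ G.tgt e = u

/-- There is a directed path from every vertex to every vertex. -/
def StronglyConnected (G : MultiDigraph V E) : Prop :=
  ∀ u v : V, ∃ p : List E, G.IsPath u v p

/-- The edges leaving `u`. -/
abbrev OutEdge (G : MultiDigraph V E) (u : V) : Type _ :=
  {e : E // G.src e = u}

/-- The number of edges leaving `u`. -/
noncomputable def outDegree (G : MultiDigraph V E) (u : V) : ℕ :=
  Nat.card (G.OutEdge u)

end MultiDigraph

/-! ### Graph-directed iterated function systems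

A GD-IFS on the real line based on `G` is a family `S : E → ContractingSimilarity`, where `S e` maps
the copy of `ℝ` at the terminal vertex of `e` to the copy of `ℝ` at its initial vertex. -/

section GraphDirected

variable {V E : Type*}

/-- `F` is the list of attractors of the GD-IFS `S`: non-empty compact sets with
`F u = ⋃ S e (F (tgt e))`, the union over the edges `e` leaving `u`. -/
def IsAttractorList (G : MultiDigraph V E) (S : E → ContractingSimilarity)
    (F : V → Set ℝ) : Prop :=
  ∀ u, (F u).Nonempty ∧ IsCompact (F u) ∧
    F u = ⋃ e : G.OutEdge u, S e '' F (G.tgt e)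

/-- The convex open set condition for a GD-IFS. -/
def COSC (G : MultiDigraph V E) (S : E → ContractingSimilarity) : Prop :=
  ∃ U : V → Set ℝ,
    (∀ u, (U u).Nonempty ∧ Bornology.IsBounded (U u) ∧ IsOpen (U u) ∧ Convex ℝ (U u)) ∧
    (∀ e, S e '' U (G.tgt e) ⊆ U (G.src e)) ∧
    ∀ e e', e ≠ e' → G.src e = G.src e' →
      Disjoint (S e '' U (G.tgt e)) (S e' '' U (G.tgt e'))

/-- The compact interval `S e (conv F (tgt e))`. -/
def edgeInterval (G : MultiDigraph V E) (S : E → ContractingSimilarity) (F : V → Set ℝ)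
    (e : E) : Set ℝ :=
  S e '' convexHull ℝ (F (G.tgt e))

/-- Left endpoint of `edgeInterval`. -/
noncomputable def leftEnd (G : MultiDigraph V E) (S : E → ContractingSimilarity)
    (F : V → Set ℝ) (e : E) : ℝ :=
  sInf (edgeInterval G S F e)

/-- Right endpoint of `edgeInterval`. -/
noncomputable def rightEnd (G : MultiDigraph V E) (S : E → ContractingSimilarity)
    (F : V → Set ℝ) (e : E) : ℝ :=
  sSup (edgeInterval G S F e)

/-- The edges leaving `u`, enumerated so that the intervals `edgeInterval` are ranked from left to
right (by their left endpoints), with the numbering starting at `0`. -/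
noncomputable def orderedEdge [Finite E] (G : MultiDigraph V E) (S : E → ContractingSimilarity)
    (F : V → Set ℝ) (u : V) (k : Fin (G.outDegree u)) : E :=
  let edge : Fin (G.outDegree u) → E := fun i => (Finite.equivFin (G.OutEdge u)).symm i
  edge (Tuple.sort (fun i => leftEnd G S F (edge i)) k)

/-- The length of the `k`-th basic gap at `u`: the distance from the right endpoint of the `k`-th
interval to the left endpoint of the next one. There are `outDegree u - 1` basic gaps at `u`. -/
noncomputable def gapLength [Finite E] (G : MultiDigraph V E) (S : E → ContractingSimilarity)
    (F : V → Set ℝ) (u : V) (k : Fin (G.outDegree u - 1)) : ℝ :=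
  leftEnd G S F (orderedEdge G S F u ⟨k + 1, by omega⟩) -
    rightEnd G S F (orderedEdge G S F u ⟨k, by omega⟩)

/-- The set of strictly positive lengths of the basic gaps at `u`. -/
def positiveGapLengths [Finite E] (G : MultiDigraph V E) (S : E → ContractingSimilarity)
    (F : V → Set ℝ) (u : V) : Set ℝ :=
  {x | 0 < x ∧ ∃ k, gapLength G S F u k = x}

/-- The absolute contraction ratio set of a GD-IFS. -/
noncomputable def absRatioSet [Finite E] (S : E → ContractingSimilarity) : Finset ℝ :=
  (Set.finite_range (fun e => |(S e).ratio|)).toFinset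

end GraphDirected

/-! ### Products of rational powers -/

/-- `A^ℚ`: all products `∏ a ^ (m a)` over `a ∈ A` with rational exponents. -/
def ratPow (A : Finset ℝ) : Set ℝ :=
  {x | ∃ m : ℝ → ℚ, x = ∏ a ∈ A, a ^ (m a : ℝ)}

/-- `A^ℚ*`: the same products, the exponents in `A` not being all zero. -/
def ratPowStar (A : Finset ℝ) : Set ℝ :=
  {x | ∃ m : ℝ → ℚ, (∃ a ∈ A, m a ≠ 0) ∧ x = ∏ a ∈ A, a ^ (m a : ℝ)}

end GDIFS

namespace GDIFS

open Set

/-! The proof compares the lengths of the gaps of `F u` as computed from the graph and from a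
hypothetical standard IFS `T`. Tracing a gap back through the pieces writes its length as `weight S
q` times a positive basic gap length at `z`, with `q` a walk from `u` to `z` (`exists_walk`).
Conditions 1 and 3 make the basic gap unique and `q` unique up to permutation
(`eq_and_perm_of_weight_mul_eq`).

By the COSC, every `f ∈ T` sends gaps of `F u` to gaps of `F u`. Iterating `f` on one basic gap and
applying the pigeonhole principle shows that `|f.ratio|` is the weight of a closed walk at `u`
(`exists_circuit_of_preserves_gaps`).

A gap of `F u` lies between two pieces of `T`, which allows finitely many lengths, or is the image
of a larger gap. In the second case its walk is, up to permutation, a closed walk at `u` followed by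
the walk of the larger gap. Hence the length of `q` is bounded linearly in the number of its edges
leaving `u`. A walk that runs many times round a circuit avoiding `u` violates this bound. -/

/-! ### Gaps of subsets of the line -/

/-- `K` has a gap of length `l`: two points of `K` at distance `l`, no point of `K` strictly
between them. -/
def HasGap (K : Set ℝ) (l : ℝ) : Prop :=
  ∃ a ∈ K, ∃ b ∈ K, a ≠ b ∧ |b - a| = l ∧ ∀ x ∈ K, 0 ≤ (x - a) * (x - b)

theorem HasGap.pos {K : Set ℝ} {l : ℝ} (h : HasGap K l) : 0 < l := by
  obtain ⟨a, -, b, -, hab, rfl, -⟩ := h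
  exact abs_pos.2 (sub_ne_zero.2 hab.symm)

theorem HasGap.exists_lt {K : Set ℝ} {l : ℝ} (h : HasGap K l) :
    ∃ a ∈ K, ∃ b ∈ K, a < b ∧ b - a = l ∧ ∀ x ∈ K, x ≤ a ∨ b ≤ x := by
  obtain ⟨a, ha, b, hb, hab, rfl, h⟩ := h
  rcases lt_or_gt_of_ne hab with hlt | hlt
  · refine ⟨a, ha, b, hb, hlt, (abs_of_pos (sub_pos.2 hlt)).symm, fun x hx => ?_⟩
    by_contra! hc
    nlinarith [h x hx, mul_pos (sub_pos.2 hc.1) (sub_pos.2 hc.2)]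
  · refine ⟨b, hb, a, ha, hlt, ?_, fun x hx => ?_⟩
    · rw [abs_sub_comm, abs_of_pos (sub_pos.2 hlt)]
    by_contra! hc
    nlinarith [h x hx, mul_pos (sub_pos.2 hc.1) (sub_pos.2 hc.2)]

theorem HasGap.of_lt {K : Set ℝ} {a b : ℝ} (ha : a ∈ K) (hb : b ∈ K) (hab : a < b)
    (h : ∀ x ∈ K, x ≤ a ∨ b ≤ x) : HasGap K (b - a) := by
  refine ⟨a, ha, b, hb, hab.ne, abs_of_pos (sub_pos.2 hab), fun x hx => ?_⟩
  rcases h x hx with h | h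
  · exact mul_nonneg_of_nonpos_of_nonpos (by linarith) (by linarith)
  · exact mul_nonneg (by linarith) (by linarith)

/-! ### Similarities, hulls and distances -/

theorem ContractingSimilarity.sub_eq (f : ContractingSimilarity) (x y : ℝ) :
    f x - f y = f.ratio * (x - y) := by
  simp only [ContractingSimilarity.toFun]; ring

theorem ContractingSimilarity.injective (f : ContractingSimilarity) : Function.Injective f := by
  intro x y hxy
  have := f.sub_eq x y
  rw [hxy, sub_self, eq_comm, mul_eq_zero] at this
  exact sub_eq_zero.1 (this.resolve_left f.ratio_ne_zero)

theorem ContractingSimilarity.continuous (f : ContractingSimilarity) : Continuous f := by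
  unfold ContractingSimilarity.toFun; fun_prop

theorem ContractingSimilarity.image_convexHull (f : ContractingSimilarity) (s : Set ℝ) :
    f '' convexHull ℝ s = convexHull ℝ (f '' s) := by
  let g : ℝ →ᵃ[ℝ] ℝ := (f.ratio • LinearMap.id : ℝ →ₗ[ℝ] ℝ).toAffineMap +
    AffineMap.const ℝ ℝ f.shift
  have h : f.toFun = g := by
    ext x; simp [ContractingSimilarity.toFun, g]
  rw [h]
  exact g.image_convexHull s

theorem ContractingSimilarity.convex_image (f : ContractingSimilarity) {s : Set ℝ}
    (hs : Convex ℝ s) : Convex ℝ (f '' s) := by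
  rw [← hs.convexHull_eq, f.image_convexHull]; exact convex_convexHull ℝ (f '' s)

theorem ContractingSimilarity.infDist_image (f : ContractingSimilarity) {s : Set ℝ}
    (hs : s.Nonempty) (x : ℝ) :
    Metric.infDist (f x) (f '' s) ≤ |f.ratio| * Metric.infDist x s := by
  have hpos : 0 < |f.ratio| := abs_pos.2 f.ratio_ne_zero
  rw [← div_le_iff₀' hpos, Metric.le_infDist hs]
  intro y hy
  rw [div_le_iff₀' hpos]
  refine (Metric.infDist_le_dist_of_mem (mem_image_of_mem f hy)).trans_eq ?_
  rw [Real.dist_eq, f.sub_eq, abs_mul, Real.dist_eq]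

/-- Disjoint convex subsets of the line are ordered, and so are their closures. -/
theorem closure_le_or_le_of_disjoint {s t : Set ℝ} (hs : Convex ℝ s) (ht : Convex ℝ t)
    (h : Disjoint s t) :
    (∀ x ∈ closure s, ∀ y ∈ closure t, x ≤ y) ∨ (∀ x ∈ closure s, ∀ y ∈ closure t, y ≤ x) := by
  have key : ∀ {s t : Set ℝ}, Convex ℝ s → Convex ℝ t → Disjoint s t →
      (∃ x ∈ s, ∃ y ∈ t, x < y) → ∀ x ∈ closure s, ∀ y ∈ closure t, x ≤ y := by
    rintro s t hs ht h ⟨x₀, hx₀, y₀, hy₀, hlt⟩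
    have hst : ∀ x ∈ s, ∀ y ∈ t, x ≤ y := by
      intro x hx y hy
      by_contra! hyx
      rcases le_total y x₀ with hle | hle
      · exact Set.disjoint_left.1 h hx₀ (ht.ordConnected.out hy hy₀ ⟨hle, hlt.le⟩)
      · exact Set.disjoint_left.1 h (hs.ordConnected.out hx₀ hx ⟨hle, hyx.le⟩) hy
    intro x hx y hy
    have h1 : ∀ y ∈ t, x ≤ y := fun y hy =>
      closure_minimal (fun x hx => hst x hx y hy) isClosed_Iic hx
    exact closure_minimal h1 isClosed_Ici hy
  by_cases hex : ∃ x ∈ s, ∃ y ∈ t, x < y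
  · exact Or.inl (key hs ht h hex)
  right
  by_cases hex' : ∃ y ∈ t, ∃ x ∈ s, y < x
  · exact fun x hx y hy => key ht hs h.symm hex' y hy x hx
  push Not at hex hex'
  intro x hx y hy
  rcases s.eq_empty_or_nonempty with rfl | ⟨x₀, hx₀⟩
  · simp at hx
  rcases t.eq_empty_or_nonempty with rfl | ⟨y₀, hy₀⟩
  · simp at hy
  exact absurd (le_antisymm (hex' y₀ hy₀ x₀ hx₀) (hex x₀ hx₀ y₀ hy₀))
    fun he => Set.disjoint_left.1 h hx₀ (he ▸ hy₀)

/-! ### Ordered hulls -/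

section

variable {V E : Type*} {G : MultiDigraph V E} {S : E → ContractingSimilarity} {F : V → Set ℝ}

/-- The convex hulls of the pieces of each attractor do not overlap. -/
def HullsOrdered (G : MultiDigraph V E) (S : E → ContractingSimilarity) (F : V → Set ℝ) : Prop :=
  ∀ e e', e ≠ e' → G.src e = G.src e' →
    (∀ x ∈ F (G.tgt e), ∀ y ∈ F (G.tgt e'), S e x ≤ S e' y) ∨
    (∀ x ∈ F (G.tgt e), ∀ y ∈ F (G.tgt e'), S e' y ≤ S e x)

theorem IsAttractorList.map_mem (hF : IsAttractorList G S F) (e : E) {x : ℝ}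
    (hx : x ∈ F (G.tgt e)) : S e x ∈ F (G.src e) := by
  rw [(hF (G.src e)).2.2]
  exact mem_iUnion.2 ⟨⟨e, rfl⟩, mem_image_of_mem _ hx⟩

theorem IsAttractorList.exists_of_mem (hF : IsAttractorList G S F) {w : V} {x : ℝ}
    (hx : x ∈ F w) : ∃ e, G.src e = w ∧ ∃ y ∈ F (G.tgt e), S e y = x := by
  rw [(hF w).2.2] at hx
  obtain ⟨e, y, hy, h⟩ := mem_iUnion.1 hx
  exact ⟨e.1, e.2, y, hy, h⟩

/-- A point at the largest distance from its `U z`, over all vertices, is the image of a point of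
another attractor, so its distance is at most a ratio less than 1 times the same maximum, hence
zero. The sets `U w` may be unbounded, which is needed for `StandardCOSC`. -/
theorem IsAttractorList.subset_closure [Finite V] (hF : IsAttractorList G S F) {U : V → Set ℝ}
    (hne : ∀ w, (U w).Nonempty) (hU : ∀ e, S e '' U (G.tgt e) ⊆ U (G.src e)) (w : V) :
    F w ⊆ closure (U w) := by
  have hmax : ∀ z, ∃ x ∈ F z, ∀ y ∈ F z, Metric.infDist y (U z) ≤ Metric.infDist x (U z) :=
    fun z => (hF z).2.1.exists_isMaxOn (hF z).1 (Metric.continuous_infDist_pt _).continuousOn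
  choose m hm hmle using hmax
  have : Nonempty V := ⟨w⟩
  obtain ⟨z, hz⟩ := Finite.exists_max fun z => Metric.infDist (m z) (U z)
  have hzero : Metric.infDist (m z) (U z) ≤ 0 := by
    obtain ⟨e, he, y, hy, hye⟩ := hF.exists_of_mem (hm z)
    have h1 : Metric.infDist (m z) (U z) ≤ |(S e).ratio| * Metric.infDist y (U (G.tgt e)) := by
      refine le_trans ?_ ((S e).infDist_image (hne (G.tgt e)) y)
      rw [hye, ← he]
      exact Metric.infDist_le_infDist_of_subset (hU e) ((hne _).image _)
    have h2 := (hmle _ y hy).trans (hz (G.tgt e))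
    have h3 := mul_le_mul_of_nonneg_left h2 (abs_nonneg (S e).ratio)
    nlinarith [(S e).abs_ratio_lt_one]
  intro x hx
  rw [Metric.mem_closure_iff_infDist_zero (hne w)]
  exact le_antisymm (((hmle w x hx).trans (hz w)).trans hzero) Metric.infDist_nonneg

theorem IsAttractorList.hullsOrdered [Finite V] (hF : IsAttractorList G S F) {U : V → Set ℝ}
    (hne : ∀ w, (U w).Nonempty) (hconv : ∀ w, Convex ℝ (U w))
    (hU : ∀ e, S e '' U (G.tgt e) ⊆ U (G.src e))
    (hdisj : ∀ e e', e ≠ e' → G.src e = G.src e' →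
      Disjoint (S e '' U (G.tgt e)) (S e' '' U (G.tgt e'))) :
    HullsOrdered G S F := by
  have hmem : ∀ e, ∀ x ∈ F (G.tgt e), S e x ∈ closure (S e '' U (G.tgt e)) := fun e x hx =>
    image_closure_subset_closure_image (S e).continuous
      (mem_image_of_mem _ (hF.subset_closure hne hU _ hx))
  intro e e' hee hsrc
  rcases closure_le_or_le_of_disjoint ((S e).convex_image (hconv _))
    ((S e').convex_image (hconv _)) (hdisj e e' hee hsrc) with h | h
  · exact Or.inl fun x hx y hy => h _ (hmem e x hx) _ (hmem e' y hy)
  · exact Or.inr fun x hx y hy => h _ (hmem e x hx) _ (hmem e' y hy)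

/-! ### Gaps of attractors -/

/-- Every other piece lies on one side of the whole piece of `e`, so it cannot enter the gap. Within
the piece the product in `HasGap` is scaled by the squared ratio, so reflections need no separate
case. -/
theorem HullsOrdered.hasGap_src (hO : HullsOrdered G S F) (hF : IsAttractorList G S F) (e : E)
    {l : ℝ} (h : HasGap (F (G.tgt e)) l) : HasGap (F (G.src e)) (|(S e).ratio| * l) := by
  obtain ⟨a, ha, b, hb, hab, rfl, h⟩ := h
  refine ⟨S e a, hF.map_mem e ha, S e b, hF.map_mem e hb, (S e).injective.ne hab, ?_, ?_⟩
  · rw [(S e).sub_eq, abs_mul]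
  intro x hx
  obtain ⟨e', he', y, hy, rfl⟩ := hF.exists_of_mem hx
  by_cases hee : e' = e
  · subst hee
    rw [(S e').sub_eq, (S e').sub_eq]
    nlinarith [mul_nonneg (sq_nonneg (S e').ratio) (h y hy)]
  rcases hO e' e hee he' with h' | h'
  · exact mul_nonneg_of_nonpos_of_nonpos (sub_nonpos.2 (h' y hy a ha)) (sub_nonpos.2 (h' y hy b hb))
  · exact mul_nonneg (sub_nonneg.2 (h' y hy a ha)) (sub_nonneg.2 (h' y hy b hb))

theorem isLeast_leftEnd (hF : IsAttractorList G S F) (e : E) :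
    IsLeast (S e '' F (G.tgt e)) (leftEnd G S F e) := by
  obtain ⟨m, hm⟩ := ((hF (G.tgt e)).2.1.image (S e).continuous).exists_isLeast
    ((hF (G.tgt e)).1.image (S e))
  have h : leftEnd G S F e = m := by
    refine IsLeast.csInf_eq ⟨?_, ?_⟩
    · rw [edgeInterval, ContractingSimilarity.image_convexHull]
      exact subset_convexHull ℝ _ hm.1
    · rw [edgeInterval, ContractingSimilarity.image_convexHull]
      exact convexHull_min (t := Ici m) hm.2 (convex_Ici m)
  rwa [h]

theorem isGreatest_rightEnd (hF : IsAttractorList G S F) (e : E) :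
    IsGreatest (S e '' F (G.tgt e)) (rightEnd G S F e) := by
  obtain ⟨m, hm⟩ := ((hF (G.tgt e)).2.1.image (S e).continuous).exists_isGreatest
    ((hF (G.tgt e)).1.image (S e))
  have h : rightEnd G S F e = m := by
    refine IsGreatest.csSup_eq ⟨?_, ?_⟩
    · rw [edgeInterval, ContractingSimilarity.image_convexHull]
      exact subset_convexHull ℝ _ hm.1
    · rw [edgeInterval, ContractingSimilarity.image_convexHull]
      exact convexHull_min (t := Iic m) hm.2 (convex_Iic m)
  rwa [h]

theorem leftEnd_mem (hF : IsAttractorList G S F) (e : E) : leftEnd G S F e ∈ F (G.src e) := by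
  obtain ⟨x, hx, h⟩ := (isLeast_leftEnd hF e).1
  exact h ▸ hF.map_mem e hx

theorem rightEnd_mem (hF : IsAttractorList G S F) (e : E) : rightEnd G S F e ∈ F (G.src e) := by
  obtain ⟨x, hx, h⟩ := (isGreatest_rightEnd hF e).1
  exact h ▸ hF.map_mem e hx

theorem leftEnd_le_rightEnd (hF : IsAttractorList G S F) (e : E) :
    leftEnd G S F e ≤ rightEnd G S F e :=
  (isLeast_leftEnd hF e).2 (isGreatest_rightEnd hF e).1

theorem leftEnd_lt_rightEnd (hF : IsAttractorList G S F) (e : E)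
    (hn : (F (G.tgt e)).Nontrivial) : leftEnd G S F e < rightEnd G S F e := by
  obtain ⟨x, hx, y, hy, hxy⟩ := hn.image (S e).injective
  refine (leftEnd_le_rightEnd hF e).lt_of_ne fun h => hxy ?_
  have h1 := isLeast_leftEnd hF e
  have h2 := isGreatest_rightEnd hF e
  exact le_antisymm (((h2.2 hx).trans_eq h.symm).trans (h1.2 hy))
    (((h2.2 hy).trans_eq h.symm).trans (h1.2 hx))

theorem HullsOrdered.rightEnd_le_leftEnd_or (hO : HullsOrdered G S F)
    (hF : IsAttractorList G S F) {e e' : E} (hee : e ≠ e') (hsrc : G.src e = G.src e') :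
    rightEnd G S F e ≤ leftEnd G S F e' ∨ rightEnd G S F e' ≤ leftEnd G S F e := by
  obtain ⟨x, hx, hx'⟩ := (isGreatest_rightEnd hF e).1
  obtain ⟨y, hy, hy'⟩ := (isLeast_leftEnd hF e').1
  obtain ⟨z, hz, hz'⟩ := (isLeast_leftEnd hF e).1
  obtain ⟨t, ht, ht'⟩ := (isGreatest_rightEnd hF e').1
  rw [← hx', ← hy', ← hz', ← ht']
  exact (hO e e' hee hsrc).imp (fun h => h x hx y hy) fun h => h z hz t ht

/-- A gap of `F w` either comes from a gap of a piece of `F w` or separates two pieces. -/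
theorem HullsOrdered.gap_cases (hO : HullsOrdered G S F) (hF : IsAttractorList G S F) {w : V}
    {l : ℝ} (hl : HasGap (F w) l) :
    (∃ e, G.src e = w ∧ ∃ l', HasGap (F (G.tgt e)) l' ∧ l = |(S e).ratio| * l') ∨
    ∃ e e', G.src e = w ∧ G.src e' = w ∧ l = leftEnd G S F e' - rightEnd G S F e ∧
      rightEnd G S F e < leftEnd G S F e' ∧
      (∀ x ∈ F w, x ≤ rightEnd G S F e ∨ leftEnd G S F e' ≤ x) ∧
      ∀ e'', G.src e'' = w → rightEnd G S F e ∈ S e'' '' F (G.tgt e'') →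
        leftEnd G S F e' ∉ S e'' '' F (G.tgt e'') := by
  obtain ⟨a, ha, b, hb, hab, rfl, h⟩ := hl.exists_lt
  by_cases hex : ∃ e, G.src e = w ∧ a ∈ S e '' F (G.tgt e) ∧ b ∈ S e '' F (G.tgt e)
  · obtain ⟨e, he, ⟨x, hx, rfl⟩, y, hy, rfl⟩ := hex
    refine Or.inl ⟨e, he, |y - x|, ⟨x, hx, y, hy, fun h => hab.ne (by rw [h]), rfl, ?_⟩, ?_⟩
    · intro t ht
      have hp : 0 ≤ (S e t - S e x) * (S e t - S e y) := by
        rcases h (S e t) (he ▸ hF.map_mem e ht) with h | h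
        · exact mul_nonneg_of_nonpos_of_nonpos (by linarith) (by linarith)
        · exact mul_nonneg (by linarith) (by linarith)
      rw [(S e).sub_eq, (S e).sub_eq] at hp
      have hr : 0 < (S e).ratio ^ 2 := by have := (S e).ratio_ne_zero; positivity
      refine nonneg_of_mul_nonneg_right (a := (S e).ratio ^ 2) ?_ hr
      linarith
    · rw [← abs_mul, ← (S e).sub_eq, abs_of_pos (sub_pos.2 hab)]
  right
  push Not at hex
  obtain ⟨e, he, x, hx, hxa⟩ := hF.exists_of_mem ha
  obtain ⟨e', he', y, hy, hyb⟩ := hF.exists_of_mem hb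
  have ha' : a ∈ S e '' F (G.tgt e) := ⟨x, hx, hxa⟩
  have hb' : b ∈ S e' '' F (G.tgt e') := ⟨y, hy, hyb⟩
  have hee : e ≠ e' := by
    rintro rfl
    exact hex e he ha' hb'
  have hle : rightEnd G S F e ≤ leftEnd G S F e' := by
    refine (hO.rightEnd_le_leftEnd_or hF hee (he.trans he'.symm)).resolve_right fun hc => ?_
    linarith [(isGreatest_rightEnd hF e').2 hb', (isLeast_leftEnd hF e).2 ha']
  have h1 : rightEnd G S F e = a := by
    refine le_antisymm ?_ ((isGreatest_rightEnd hF e).2 ha')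
    -- Were the right end beyond the gap, it would equal `b`, and the piece of `e` would contain
    -- both `a` and `b`.
    refine (h _ (he ▸ rightEnd_mem hF e)).resolve_right fun hc => ?_
    have : rightEnd G S F e = b := le_antisymm (hle.trans ((isLeast_leftEnd hF e').2 hb')) hc
    exact hex e he ha' (this ▸ (isGreatest_rightEnd hF e).1)
  have h2 : leftEnd G S F e' = b := by
    refine le_antisymm ((isLeast_leftEnd hF e').2 hb') ?_
    refine (h _ (he' ▸ leftEnd_mem hF e')).resolve_left fun hc => ?_
    have : leftEnd G S F e' = a := le_antisymm hc (h1 ▸ hle)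
    exact hex e' he' (this ▸ (isLeast_leftEnd hF e').1) hb'
  refine ⟨e, e', he, he', ?_, ?_, ?_, ?_⟩ <;> rw [h1, h2]
  exacts [hab, h, hex]

end

section

variable {V E : Type*} [Finite E] {G : MultiDigraph V E} {S : E → ContractingSimilarity}
  {F : V → Set ℝ}

/-! ### Basic gaps -/

theorem src_orderedEdge (w : V) (k : Fin (G.outDegree w)) : G.src (orderedEdge G S F w k) = w :=
  ((Finite.equivFin (G.OutEdge w)).symm _).2

theorem exists_orderedEdge_eq (e : E) : ∃ k, orderedEdge G S F (G.src e) k = e := by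
  obtain ⟨i, hi⟩ := (Finite.equivFin (G.OutEdge (G.src e))).symm.surjective ⟨e, rfl⟩
  obtain ⟨k, hk⟩ := (Tuple.sort fun i =>
    leftEnd G S F ((Finite.equivFin (G.OutEdge (G.src e))).symm i).1).surjective i
  exact ⟨k, congrArg Subtype.val
    ((congrArg (Finite.equivFin (G.OutEdge (G.src e))).symm hk).trans hi)⟩

theorem orderedEdge_injective (w : V) : Function.Injective (orderedEdge G S F w) := by
  intro i j hij
  exact (Tuple.sort _).injective ((Finite.equivFin (G.OutEdge w)).symm.injective (Subtype.ext hij))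

theorem leftEnd_orderedEdge_mono (w : V) :
    Monotone fun k => leftEnd G S F (orderedEdge G S F w k) :=
  Tuple.monotone_sort fun i => leftEnd G S F ((Finite.equivFin (G.OutEdge w)).symm i).1

theorem leftEnd_orderedEdge_mem (hF : IsAttractorList G S F) (w : V) (k : Fin (G.outDegree w)) :
    leftEnd G S F (orderedEdge G S F w k) ∈ F w := by
  simpa only [src_orderedEdge] using leftEnd_mem hF (orderedEdge G S F w k)

theorem rightEnd_orderedEdge_mem (hF : IsAttractorList G S F) (w : V) (k : Fin (G.outDegree w)) :
    rightEnd G S F (orderedEdge G S F w k) ∈ F w := by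
  simpa only [src_orderedEdge] using rightEnd_mem hF (orderedEdge G S F w k)

theorem nontrivial_of_positiveGapLengths (hF : IsAttractorList G S F) {w : V}
    (h : (positiveGapLengths G S F w).Nonempty) : (F w).Nontrivial := by
  obtain ⟨l, hl, k, hk⟩ := h
  refine ⟨rightEnd G S F (orderedEdge G S F w ⟨k, by omega⟩), ?_,
    leftEnd G S F (orderedEdge G S F w ⟨k + 1, by omega⟩), ?_, ?_⟩
  · exact rightEnd_orderedEdge_mem hF w _
  · exact leftEnd_orderedEdge_mem hF w _
  · rw [gapLength] at hk
    intro h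
    linarith

/-- The enumeration sorts by left ends only. Nontrivial attractors give intervals of positive
length, which excludes the opposite order. -/
theorem HullsOrdered.rightEnd_le_leftEnd (hO : HullsOrdered G S F) (hF : IsAttractorList G S F)
    (hn : ∀ w, (F w).Nontrivial) {w : V} {i j : Fin (G.outDegree w)} (hij : i < j) :
    rightEnd G S F (orderedEdge G S F w i) ≤ leftEnd G S F (orderedEdge G S F w j) := by
  refine (hO.rightEnd_le_leftEnd_or hF ((orderedEdge_injective w).ne hij.ne)
    ((src_orderedEdge w i).trans (src_orderedEdge w j).symm)).resolve_right fun hc => ?_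
  have h1 := leftEnd_orderedEdge_mono (G := G) (S := S) (F := F) w hij.le
  have h2 := leftEnd_lt_rightEnd hF (orderedEdge G S F w j) (hn _)
  simp only at h1
  linarith

theorem HullsOrdered.hasGap_gapLength (hO : HullsOrdered G S F) (hF : IsAttractorList G S F)
    (hn : ∀ w, (F w).Nontrivial) {w : V} {k : Fin (G.outDegree w - 1)}
    (hk : 0 < gapLength G S F w k) : HasGap (F w) (gapLength G S F w k) := by
  unfold gapLength at hk ⊢
  set i : Fin (G.outDegree w) := ⟨k, by omega⟩ with hi
  set j : Fin (G.outDegree w) := ⟨k + 1, by omega⟩ with hj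
  refine HasGap.of_lt (rightEnd_orderedEdge_mem hF w i) (leftEnd_orderedEdge_mem hF w j)
    (sub_pos.1 hk) ?_
  intro x hx
  obtain ⟨e, rfl, y, hy, rfl⟩ := hF.exists_of_mem hx
  obtain ⟨m, hm⟩ := exists_orderedEdge_eq (G := G) (S := S) (F := F) e
  have hl := (isLeast_leftEnd hF e).2 (mem_image_of_mem _ hy)
  have hr := (isGreatest_rightEnd hF e).2 (mem_image_of_mem _ hy)
  rcases lt_or_ge m j with hmj | hmj
  · left
    rcases (show m ≤ i by simp only [Fin.le_def, Fin.lt_def, hi, hj] at *; omega).eq_or_lt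
      with rfl | hlt
    · rwa [hm]
    · have := hO.rightEnd_le_leftEnd hF hn hlt
      rw [hm] at this
      exact hr.trans (this.trans (leftEnd_le_rightEnd hF _))
  · right
    have := leftEnd_orderedEdge_mono (G := G) (S := S) (F := F) (G.src e) hmj
    simp only [hm] at this
    exact this.trans hl

theorem HullsOrdered.gap_cases_gapLength (hO : HullsOrdered G S F) (hF : IsAttractorList G S F)
    (hn : ∀ w, (F w).Nontrivial) {w : V} {l : ℝ} (hl : HasGap (F w) l) :
    (∃ e, G.src e = w ∧ ∃ l', HasGap (F (G.tgt e)) l' ∧ l = |(S e).ratio| * l') ∨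
    ∃ k, l = gapLength G S F w k := by
  refine (hO.gap_cases hF hl).imp_right ?_
  rintro ⟨e, e', rfl, hsrc, rfl, hlt, h, hnot⟩
  obtain ⟨i, hi⟩ := exists_orderedEdge_eq (G := G) (S := S) (F := F) e
  obtain ⟨j, hj⟩ : ∃ j, orderedEdge G S F (G.src e) j = e' :=
    hsrc ▸ exists_orderedEdge_eq (G := G) (S := S) (F := F) e'
  have hmono := leftEnd_orderedEdge_mono (G := G) (S := S) (F := F) (G.src e)
  have hij : i < j := by
    by_contra! hc
    have := hmono hc
    simp only [hi, hj] at this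
    linarith [leftEnd_le_rightEnd hF e]
  -- An interval strictly between the two in the enumeration would have its endpoints, which are
  -- points of `F w`, in the closed gap. Having positive length, it would contain both ends of the
  -- gap, contrary to `hnot`.
  have hsucc : (j : ℕ) = i + 1 := by
    by_contra hc
    have hij' : (i : ℕ) < j := hij
    have hjd := j.2
    let m : Fin (G.outDegree (G.src e)) := ⟨i + 1, by omega⟩
    have him := hO.rightEnd_le_leftEnd hF hn (show i < m from Nat.lt_succ_self _)
    have hmj := hO.rightEnd_le_leftEnd hF hn (show m < j by rw [Fin.lt_def]; simp only [m]; omega)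
    rw [hi] at him
    rw [hj] at hmj
    set e'' := orderedEdge G S F (G.src e) m with he''
    have hs : G.src e'' = G.src e := src_orderedEdge _ _
    have hlt' := leftEnd_lt_rightEnd hF e'' (hn _)
    have h1 := (h _ (hs ▸ leftEnd_mem hF e'')).resolve_right fun hc => by linarith
    have h2 := (h _ (hs ▸ rightEnd_mem hF e'')).resolve_left fun hc => by linarith
    refine hnot e'' hs ?_ ?_
    · rw [le_antisymm him h1]; exact (isLeast_leftEnd hF e'').1
    · rw [le_antisymm h2 hmj]; exact (isGreatest_rightEnd hF e'').1
  have hjd := j.2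
  refine ⟨⟨i, by omega⟩, ?_⟩
  have h1 : (⟨i + 1, by omega⟩ : Fin (G.outDegree (G.src e))) = j := Fin.ext hsucc.symm
  simp only [gapLength, h1, hj]
  simp only [Fin.eta, hi]

/-! ### Gaps along walks -/

/-- The product of the absolute contraction ratios along a list of edges. -/
def weight {E : Type*} (S : E → ContractingSimilarity) (q : List E) : ℝ :=
  (q.map fun e => |(S e).ratio|).prod

@[simp] theorem weight_nil {E : Type*} (S : E → ContractingSimilarity) : weight S [] = 1 := rfl

@[simp] theorem weight_cons {E : Type*} (S : E → ContractingSimilarity) (e : E) (q : List E) :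
    weight S (e :: q) = |(S e).ratio| * weight S q := by
  simp [weight]

theorem abs_ratio_pos (f : ContractingSimilarity) : 0 < |f.ratio| := abs_pos.2 f.ratio_ne_zero

theorem weight_pos {E : Type*} (S : E → ContractingSimilarity) (q : List E) : 0 < weight S q := by
  induction q with
  | nil => simp
  | cons e q ih => rw [weight_cons]; exact mul_pos (abs_ratio_pos _) ih

theorem weight_append {E : Type*} (S : E → ContractingSimilarity) (p q : List E) :
    weight S (p ++ q) = weight S p * weight S q := by
  simp [weight]

theorem HullsOrdered.hasGap_walk {V E : Type*} {G : MultiDigraph V E}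
    {S : E → ContractingSimilarity} {F : V → Set ℝ} (hO : HullsOrdered G S F)
    (hF : IsAttractorList G S F) {w z : V} {q : List E} (hq : G.IsWalk w z q) {l : ℝ}
    (h : HasGap (F z) l) : HasGap (F w) (weight S q * l) := by
  induction q generalizing w with
  | nil => obtain rfl : w = z := hq; simpa using h
  | cons e q ih =>
    obtain ⟨rfl, hq⟩ := hq
    rw [weight_cons, mul_assoc]
    exact hO.hasGap_src hF e (ih hq)

/-- A gap that is not basic comes from a gap longer by a factor at least `1 / r` at the next vertex.
Since gap lengths are bounded by `D`, this descent stops. -/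
theorem HullsOrdered.exists_walk [Finite V] (hO : HullsOrdered G S F) (hF : IsAttractorList G S F)
    (hn : ∀ w, (F w).Nontrivial) {w : V} {l : ℝ} (hl : HasGap (F w) l) :
    ∃ z k q, G.IsWalk w z q ∧ 0 < gapLength G S F z k ∧ l = weight S q * gapLength G S F z k := by
  obtain ⟨D, hD⟩ : ∃ D, ∀ w l, HasGap (F w) l → l ≤ D := by
    have := Fintype.ofFinite V
    refine ⟨∑ w, Metric.diam (F w), fun w l hl => ?_⟩
    obtain ⟨a, ha, b, hb, -, rfl, -⟩ := hl
    rw [← Real.dist_eq]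
    exact (Metric.dist_le_diam_of_mem (hF w).2.1.isBounded hb ha).trans
      (Finset.single_le_sum (f := fun w => Metric.diam (F w)) (fun _ _ => Metric.diam_nonneg)
        (Finset.mem_univ w))
  obtain ⟨r, hr0, hr1, hr⟩ : ∃ r : ℝ, 0 < r ∧ r < 1 ∧ ∀ e, |(S e).ratio| ≤ r := by
    rcases isEmpty_or_nonempty E with _ | _
    · exact ⟨1 / 2, by norm_num, by norm_num, isEmptyElim⟩
    · obtain ⟨e, he⟩ := Finite.exists_max fun e => |(S e).ratio|
      exact ⟨_, abs_ratio_pos _, (S e).abs_ratio_lt_one, he⟩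
  -- Here `n` bounds the number of descent steps: one step replaces `n + 1` by `n`, and `n = 0`
  -- would give a gap longer than `D`.
  have key : ∀ n : ℕ, ∀ w l, HasGap (F w) l → D * r ^ n < l →
      ∃ z k q, G.IsWalk w z q ∧ 0 < gapLength G S F z k ∧
        l = weight S q * gapLength G S F z k := by
    intro n
    induction n with
    | zero => exact fun w l hl h => absurd (hD w l hl) (by simpa using h)
    | succ n ih =>
      intro w l hl h
      rcases hO.gap_cases_gapLength hF hn hl with ⟨e, rfl, l', hl', rfl⟩ | ⟨k, rfl⟩
      · have h2 : D * r ^ n < l' := by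
          have h3 := mul_le_mul_of_nonneg_right (hr e) hl'.pos.le
          rw [pow_succ] at h
          by_contra! hc
          nlinarith [mul_le_mul_of_nonneg_right hc hr0.le]
        obtain ⟨z, k, q, hq, hk, rfl⟩ := ih _ _ hl' h2
        exact ⟨z, k, e :: q, ⟨rfl, hq⟩, hk, by rw [weight_cons, mul_assoc]⟩
      · exact ⟨w, k, [], rfl, hl.pos, by simp⟩
  have hlim : Filter.Tendsto (fun n : ℕ => D * r ^ n) Filter.atTop (nhds 0) := by
    simpa using (tendsto_pow_atTop_nhds_zero_of_lt_one hr0.le hr1).const_mul D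
  obtain ⟨n, hn⟩ := (hlim.eventually_lt_const hl.pos).exists
  exact key n w l hl hn

/-! ### Uniqueness of the representation of gap lengths -/

/-- Exponents in `ratPow` are indexed by the values of the ratios; as these are pairwise distinct,
exponents indexed by edges carry over. -/
theorem prod_rpow_mem_ratPow [Fintype E] (hS : Function.Injective fun e => |(S e).ratio|)
    (m : E → ℚ) : ∏ e, |(S e).ratio| ^ (m e : ℝ) ∈ ratPow (absRatioSet S) ∧
      (m ≠ 0 → ∏ e, |(S e).ratio| ^ (m e : ℝ) ∈ ratPowStar (absRatioSet S)) := by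
  classical
  have hA : absRatioSet S = Finset.univ.image fun e => |(S e).ratio| := by
    ext x; simp [absRatioSet]
  set g : ℝ → ℚ := Function.extend (fun e => |(S e).ratio|) m 0 with hg
  have hgm : ∀ e, g |(S e).ratio| = m e := fun e => hS.extend_apply m 0 e
  have heq : ∏ e, |(S e).ratio| ^ (m e : ℝ) = ∏ a ∈ absRatioSet S, a ^ (g a : ℝ) := by
    rw [hA, Finset.prod_image hS.injOn]
    simp only [hgm]
  refine ⟨⟨g, heq⟩, fun hm => ⟨g, ?_, heq⟩⟩
  obtain ⟨e, he⟩ := Function.ne_iff.1 hm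
  exact ⟨|(S e).ratio|, by simp [hA], by rw [hgm]; exact he⟩

theorem weight_eq_prod_rpow {E : Type*} [Fintype E] [DecidableEq E]
    (S : E → ContractingSimilarity) (q : List E) :
    weight S q = ∏ e, |(S e).ratio| ^ (((q.count e : ℕ) : ℚ) : ℝ) := by
  rw [weight, Finset.prod_list_map_count,
    Finset.prod_subset (Finset.subset_univ q.toFinset)
      (fun e _ he => by rw [List.count_eq_zero_of_not_mem (by simpa using he), pow_zero])]
  simp

theorem prod_rpow_div {E : Type*} [Fintype E]
    (S : E → ContractingSimilarity) (m m' : E → ℚ) :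
    (∏ e, |(S e).ratio| ^ (m e : ℝ)) / ∏ e, |(S e).ratio| ^ (m' e : ℝ) =
      ∏ e, |(S e).ratio| ^ (((m - m') e : ℚ) : ℝ) := by
  rw [← Finset.prod_div_distrib]
  refine Finset.prod_congr rfl fun e _ => ?_
  rw [Pi.sub_apply, Rat.cast_sub, Real.rpow_sub (abs_ratio_pos _)]

/-- If some edge had different multiplicities in `p` and `q`, dividing the weights would write 1 as
a product with a nonzero exponent. -/
theorem perm_of_weight_eq (hS : Function.Injective fun e => |(S e).ratio|)
    (hone : (1 : ℝ) ∉ ratPowStar (absRatioSet S)) {p q : List E}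
    (h : weight S p = weight S q) : p.Perm q := by
  classical
  have := Fintype.ofFinite E
  rw [List.perm_iff_count]
  by_contra! hc
  obtain ⟨e, he⟩ := hc
  refine hone ?_
  have h1 := (prod_rpow_mem_ratPow hS ((fun e => (p.count e : ℚ)) - fun e => (q.count e : ℚ))).2
  rw [← prod_rpow_div, ← weight_eq_prod_rpow, ← weight_eq_prod_rpow, h,
    div_self (weight_pos S q).ne'] at h1
  refine h1 (Function.ne_iff.2 ⟨e, ?_⟩)
  simpa [sub_eq_zero] using he

/-- A positive number with a positive power that is a quotient of weights is itself a product of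
rational powers of the ratios. -/
theorem exists_eq_prod_rpow {E : Type*} [Fintype E]
    {S : E → ContractingSimilarity} {x : ℝ} (hx : 0 < x) {n : ℕ} (hn : n ≠ 0) {p q : List E}
    (h : x ^ n = weight S p / weight S q) :
    ∃ m : E → ℚ, x = ∏ e, |(S e).ratio| ^ (m e : ℝ) := by
  classical
  rw [weight_eq_prod_rpow, weight_eq_prod_rpow,
    prod_rpow_div S (fun e => (p.count e : ℚ)) fun e => (q.count e : ℚ)] at h
  refine ⟨fun e => ((p.count e : ℚ) - (q.count e : ℚ)) / n, ?_⟩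
  refine (pow_left_inj₀ hx.le
    (Finset.prod_nonneg fun e _ => Real.rpow_nonneg (abs_nonneg _) _) hn).1 ?_
  rw [h, ← Finset.prod_pow]
  refine Finset.prod_congr rfl fun e _ => ?_
  rw [← Real.rpow_mul_natCast (abs_nonneg _)]
  congr 1
  push_cast [Pi.sub_apply]
  rw [div_mul_cancel₀ _ (Nat.cast_ne_zero.2 hn)]

end

section

variable {V E : Type*} [Finite E] {G : MultiDigraph V E}
  {S : E → ContractingSimilarity} {F : V → Set ℝ}

/-! ### Similarities that preserve the gaps of an attractor -/

/-- The two factors of a product `weight S q * gapLength G S F z k` are determined by its value. -/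
theorem eq_and_perm_of_weight_mul_eq (hS : Function.Injective fun e => |(S e).ratio|)
    (hone : (1 : ℝ) ∉ ratPowStar (absRatioSet S))
    (hratio : ∀ p q : (w : V) × Fin (G.outDegree w - 1), p ≠ q → gapLength G S F q.1 q.2 ≠ 0 →
      gapLength G S F p.1 p.2 / gapLength G S F q.1 q.2 ∉ ratPow (absRatioSet S))
    {s t : (w : V) × Fin (G.outDegree w - 1)} {p q : List E}
    (ht : 0 < gapLength G S F t.1 t.2)
    (h : weight S p * gapLength G S F s.1 s.2 = weight S q * gapLength G S F t.1 t.2) :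
    s = t ∧ p.Perm q := by
  classical
  have := Fintype.ofFinite E
  have hst : s = t := by
    by_contra hne
    refine hratio s t hne ht.ne' ?_
    have h1 : gapLength G S F s.1 s.2 / gapLength G S F t.1 t.2 = weight S q / weight S p := by
      rw [div_eq_div_iff ht.ne' (weight_pos S p).ne']
      linarith
    rw [h1, weight_eq_prod_rpow, weight_eq_prod_rpow,
      prod_rpow_div S (fun e => (q.count e : ℚ)) fun e => (p.count e : ℚ)]
    exact (prod_rpow_mem_ratPow hS _).1
  subst hst
  exact ⟨rfl, perm_of_weight_eq hS hone (mul_right_cancel₀ ht.ne' h)⟩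

/-- The gap lengths `|f.ratio| ^ n * gapLength G S F u k` all factor through finitely many basic
gaps. A repetition puts `|f.ratio|` in `A^ℚ`, after which the case `n = 1` alone identifies it as a
weight. -/
theorem HullsOrdered.exists_circuit_of_preserves_gaps [Finite V] (hO : HullsOrdered G S F)
    (hF : IsAttractorList G S F) (hn : ∀ w, (F w).Nontrivial)
    (hS : Function.Injective fun e => |(S e).ratio|)
    (hratio : ∀ p q : (w : V) × Fin (G.outDegree w - 1), p ≠ q → gapLength G S F q.1 q.2 ≠ 0 →
      gapLength G S F p.1 p.2 / gapLength G S F q.1 q.2 ∉ ratPow (absRatioSet S))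
    {u : V} (hu : (positiveGapLengths G S F u).Nonempty) (f : ContractingSimilarity)
    (hf : ∀ l, HasGap (F u) l → HasGap (F u) (|f.ratio| * l)) :
    ∃ r, G.IsWalk u u r ∧ r ≠ [] ∧ |f.ratio| = weight S r := by
  classical
  have := Fintype.ofFinite E
  obtain ⟨l, hl, k, rfl⟩ := hu
  have hpow : ∀ n : ℕ, HasGap (F u) (|f.ratio| ^ n * gapLength G S F u k) := by
    intro n
    induction n with
    | zero => simpa using hO.hasGap_gapLength hF hn hl
    | succ n ih => rw [pow_succ', mul_assoc]; exact hf _ ih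
  have hρ := abs_ratio_pos f
  have hex : ∀ n : ℕ, ∃ t : (w : V) × Fin (G.outDegree w - 1), ∃ q, G.IsWalk u t.1 q ∧
      0 < gapLength G S F t.1 t.2 ∧
      |f.ratio| ^ n * gapLength G S F u k = weight S q * gapLength G S F t.1 t.2 := by
    intro n
    obtain ⟨z, k', q, hq, hk', h⟩ := hO.exists_walk hF hn (hpow n)
    exact ⟨⟨z, k'⟩, q, hq, hk', h⟩
  choose t q hq ht h using hex
  obtain ⟨m, hm⟩ : ∃ m : E → ℚ, |f.ratio| = ∏ e, |(S e).ratio| ^ (m e : ℝ) := by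
    -- Two exponents sharing a basic gap make `|f.ratio| ^ (j - i)` a quotient of weights.
    obtain ⟨i, j, hij, htij⟩ : ∃ i j, i < j ∧ t i = t j := by
      obtain ⟨i, j, hne, hij⟩ := Finite.exists_ne_map_eq_of_infinite t
      rcases hne.lt_or_gt with hlt | hlt
      exacts [⟨i, j, hlt, hij⟩, ⟨j, i, hlt, hij.symm⟩]
    have hi := h i
    have hj := h j
    have hpos := ht j
    rw [htij] at hi
    refine exists_eq_prod_rpow (S := S) hρ (n := j - i) (by omega) (p := q j) (q := q i) ?_
    rw [eq_div_iff (weight_pos S _).ne']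
    have hij' : |f.ratio| ^ j = |f.ratio| ^ i * |f.ratio| ^ (j - i) := by
      rw [← pow_add]; congr 1; omega
    rw [hij'] at hj
    refine mul_right_cancel₀ hpos.ne' ?_
    rw [← hj, mul_assoc, ← hi]
    ring
  have h1 := h 1
  rw [pow_one] at h1
  -- Otherwise the quotient of two different basic gap lengths would be a weight over `|f.ratio|`,
  -- an element of `A^ℚ`. The equality makes the walk for `n = 1` end at `u`.
  have heq : (⟨u, k⟩ : (w : V) × Fin (G.outDegree w - 1)) = t 1 := by
    by_contra hne
    refine hratio _ _ hne (ht 1).ne' ?_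
    have h2 : gapLength G S F u k / gapLength G S F (t 1).1 (t 1).2 =
        weight S (q 1) / |f.ratio| := by
      rw [div_eq_div_iff (ht 1).ne' hρ.ne']
      linarith
    rw [h2, weight_eq_prod_rpow, hm, prod_rpow_div S (fun e => ((q 1).count e : ℚ)) m]
    exact (prod_rpow_mem_ratPow hS _).1
  have hq1 := hq 1
  rw [← heq] at h1 hq1
  have hw : |f.ratio| = weight S (q 1) := mul_right_cancel₀ hl.ne' h1
  refine ⟨q 1, hq1, ?_, hw⟩
  intro hnil
  rw [hnil, weight_nil] at hw
  exact f.abs_ratio_lt_one.ne hw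

end

/-! ### Walks -/

namespace MultiDigraph

variable {V E : Type*} {G : MultiDigraph V E}

theorem IsWalk.append {u v w : V} {p q : List E} (hp : G.IsWalk u v p) (hq : G.IsWalk v w q) :
    G.IsWalk u w (p ++ q) := by
  induction p generalizing u with
  | nil => obtain rfl : u = v := hp; exact hq
  | cons e p ih => exact ⟨hp.1, ih hp.2⟩

theorem IsWalk.flatten_replicate {v : V} {p : List E} (hp : G.IsWalk v v p) (n : ℕ) :
    G.IsWalk v v (List.replicate n p).flatten := by
  induction n with
  | zero => exact rfl
  | succ n ih => rw [List.replicate_succ, List.flatten_cons]; exact hp.append ih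

end MultiDigraph

/-! ### A standard IFS as a graph-directed one -/

/-- The graph with one vertex and one loop for each member of `T`. -/
def bouquet (T : Finset ContractingSimilarity) : MultiDigraph Unit T :=
  ⟨fun _ => (), fun _ => ()⟩

/-- This makes the results on gaps of graph-directed attractors available for `T`. -/
theorem IsAttractor.isAttractorList {T : Finset ContractingSimilarity} {K : Set ℝ}
    (h : IsAttractor T K) : IsAttractorList (bouquet T) (fun f => f.1) fun _ => K := by
  refine fun _ => ⟨h.1, h.2.1, h.2.2.trans ?_⟩
  ext x
  simp only [mem_iUnion]
  exact ⟨fun ⟨f, hf, hx⟩ => ⟨⟨⟨f, hf⟩, rfl⟩, hx⟩, fun ⟨f, hx⟩ => ⟨f.1.1, f.1.2, hx⟩⟩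

theorem StandardCOSC.hullsOrdered {T : Finset ContractingSimilarity} {K : Set ℝ}
    (hT : StandardCOSC T) (h : IsAttractor T K) :
    HullsOrdered (bouquet T) (fun f => f.1) fun _ => K := by
  obtain ⟨U, hne, -, hconv, hU, hdisj⟩ := hT
  exact h.isAttractorList.hullsOrdered (U := fun _ => U) (fun _ => hne) (fun _ => hconv)
    (fun f => hU f.1 f.2) fun f g hfg _ =>
      hdisj f.1 f.2 g.1 g.2 fun hc => hfg (Subtype.ext hc)

/-! ### Counting the edges that leave `u` -/

theorem not_isAttractor_of_circuit {V E : Type*} [Finite V] [Finite E] {G : MultiDigraph V E}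
    {S : E → ContractingSimilarity} {F : V → Set ℝ} (hconn : G.StronglyConnected)
    (hO : HullsOrdered G S F) (hF : IsAttractorList G S F)
    (hS : Function.Injective fun e => |(S e).ratio|)
    (hone : (1 : ℝ) ∉ ratPowStar (absRatioSet S))
    (hgap : ∀ w, (positiveGapLengths G S F w).Nonempty)
    (hratio : ∀ p q : (w : V) × Fin (G.outDegree w - 1), p ≠ q → gapLength G S F q.1 q.2 ≠ 0 →
      gapLength G S F p.1 p.2 / gapLength G S F q.1 q.2 ∉ ratPow (absRatioSet S))
    {u : V} {L : List E} (hL : G.IsCircuit L) (hLu : ¬ G.PassesThrough L u)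
    {T : Finset ContractingSimilarity} (hT : StandardCOSC T) : ¬ IsAttractor T (F u) := by
  classical
  intro hK
  have hn := fun w => nontrivial_of_positiveGapLengths hF (hgap w)
  have hKO := hT.hullsOrdered hK
  have hKF := hK.isAttractorList
  have hcirc := fun f : T => hO.exists_circuit_of_preserves_gaps hF hn hS hratio (hgap u) f.1
    fun l hl => hKO.hasGap_src hKF f hl
  choose r hr hrne hrw using hcirc
  obtain ⟨R, hR⟩ : ∃ R, ∀ f, (r f).length ≤ R :=
    ⟨_, fun f => Finset.le_sup (f := fun f => (r f).length) (Finset.mem_univ f)⟩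
  -- All walks representing `l` are permutations of one another, so they have one length; 0 serves
  -- when there is none.
  have hbound : ∀ l : ℝ, ∃ N, ∀ (z : V) (k : Fin (G.outDegree z - 1)) (q : List E),
      0 < gapLength G S F z k → weight S q * gapLength G S F z k = l → q.length ≤ N := by
    intro l
    by_cases hex : ∃ (z : V) (k : Fin (G.outDegree z - 1)) (q : List E),
      0 < gapLength G S F z k ∧ weight S q * gapLength G S F z k = l
    · obtain ⟨z, k, q, hk, h⟩ := hex
      refine ⟨q.length, fun z' k' q' hk' h' => ?_⟩
      exact (eq_and_perm_of_weight_mul_eq (s := ⟨z', k'⟩) (t := ⟨z, k⟩) hS hone hratio hk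
        (h'.trans h.symm)).2.length_eq.le
    · exact ⟨0, fun z k q hk h => absurd ⟨z, k, q, hk, h⟩ hex⟩
  choose N hN using hbound
  -- `Q` covers all gaps between two pieces of `T`; ranging over all ordered pairs, adjacent or not,
  -- is harmless.
  obtain ⟨Q, hQ⟩ : ∃ Q, ∀ f g : T, N (leftEnd (bouquet T) (fun f => f.1) (fun _ => F u) g -
      rightEnd (bouquet T) (fun f => f.1) (fun _ => F u) f) ≤ Q :=
    ⟨_, fun f g => Finset.le_sup (f := fun p : T × T =>
      N (leftEnd (bouquet T) (fun f => f.1) (fun _ => F u) p.2 -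
        rightEnd (bouquet T) (fun f => f.1) (fun _ => F u) p.1)) (Finset.mem_univ (f, g))⟩
  -- The key inequality, by strong induction on the length: removing a closed walk `r f` costs at
  -- most `R` edges and removes at least one edge leaving `u`, since `r f` starts there.
  have hlen : ∀ n, ∀ (z : V) (k : Fin (G.outDegree z - 1)) (q : List E), q.length = n →
      G.IsWalk u z q → 0 < gapLength G S F z k →
      q.length ≤ Q + R * q.countP fun e => G.src e = u := by
    intro n
    induction n using Nat.strong_induction_on with
    | _ n ih =>
      rintro z k q rfl hq hk
      rcases hKO.gap_cases (w := ()) hKF (hO.hasGap_walk hF hq (hO.hasGap_gapLength hF hn hk)) with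
        ⟨f, -, l', hl', h⟩ | ⟨f, g, -, -, h, -⟩
      · obtain ⟨z', k', q', hq', hk', rfl⟩ := hO.exists_walk hF hn hl'
        rw [hrw, ← mul_assoc, ← weight_append] at h
        have hperm := (eq_and_perm_of_weight_mul_eq (s := ⟨z, k⟩) (t := ⟨z', k'⟩) hS hone hratio
          hk' h).2
        have hlen := hperm.length_eq
        rw [List.length_append] at hlen
        have hcount := hperm.countP_eq fun e => G.src e = u
        rw [List.countP_append] at hcount
        have hcf : 1 ≤ (r f).countP fun e => G.src e = u := by
          have h1 := hr f
          have h2 := hrne f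
          cases hrf : r f with
          | nil => exact absurd hrf h2
          | cons e p =>
            rw [hrf] at h1
            simp [h1.1]
        have hpos := List.length_pos_iff.2 (hrne f)
        have hrec := ih q'.length (by omega) z' k' q' rfl hq' hk'
        have hRf := hR f
        rw [hlen, hcount]
        nlinarith [Nat.mul_le_mul_left R hcf]
      · exact ((hN _ z k q hk h).trans (hQ f g)).trans (Nat.le_add_right _ _)
  obtain ⟨v, hLne, hLw⟩ := hL
  obtain ⟨p, -, hp⟩ := hconn u v
  obtain ⟨l, hl, k, rfl⟩ := hgap v
  have hLc : (L.countP fun e => G.src e = u) = 0 := by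
    rw [List.countP_eq_zero]
    intro e he h
    exact hLu ⟨e, he, Or.inl (by simpa using h)⟩
  -- The turns round `L` add no edge leaving `u`, so the bound stays at its value for `p`, and the
  -- number of turns is chosen to exceed it by one.
  have hcontra := hlen _ v k
    (p ++ (List.replicate (Q + R * (p.countP fun e => G.src e = u) + 1) L).flatten) rfl
    (hp.append (hLw.flatten_replicate _)) hl
  have hLpos := List.length_pos_iff.2 hLne
  simp only [List.countP_append, List.length_append, List.length_flatten, List.map_replicate,
    List.sum_replicate, List.countP_flatten, hLc, smul_eq_mul, mul_zero, add_zero] at hcontra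
  have := Nat.le_mul_of_pos_right (Q + R * (p.countP fun e => G.src e = u) + 1) hLpos
  omega

end GDIFS

theorem lemma4p4 {V E : Type*} [Finite V] [Finite E]
    (G : GDIFS.MultiDigraph V E)
    (hconn : G.StronglyConnected)
    (hdeg : ∀ w, 2 ≤ G.outDegree w)
    (S : E → GDIFS.ContractingSimilarity)
    (hcosc : GDIFS.COSC G S)
    (F : V → Set ℝ)
    (hF : GDIFS.IsAttractorList G S F)
    (hdistinct : Function.Injective (fun e => |(S e).ratio|))
    (hone : (1 : ℝ) ∉ GDIFS.ratPowStar (GDIFS.absRatioSet S))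
    (hgap : ∀ w, (GDIFS.positiveGapLengths G S F w).Nonempty)
    (hratio : ∀ p q : (w : V) × Fin (G.outDegree w - 1), p ≠ q →
      GDIFS.gapLength G S F q.1 q.2 ≠ 0 →
      GDIFS.gapLength G S F p.1 p.2 / GDIFS.gapLength G S F q.1 q.2 ∉
        GDIFS.ratPow (GDIFS.absRatioSet S))
    (u : V)
    (hu : ∃ L : List E, G.IsCircuit L ∧ ¬ G.PassesThrough L u) :
    ¬ ∃ T : Finset GDIFS.ContractingSimilarity,
      GDIFS.StandardCOSC T ∧ GDIFS.IsAttractor T (F u) := by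
  rintro ⟨T, hT, hK⟩
  obtain ⟨L, hL, hLu⟩ := hu
  obtain ⟨U, hU, hsub, hdisj⟩ := hcosc
  exact GDIFS.not_isAttractor_of_circuit hconn
    (hF.hullsOrdered (fun w => (hU w).1) (fun w => (hU w).2.2.2) hsub hdisj)
    hF hdistinct hone hgap hratio hL hLu hT hK
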